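/- Let $d>1$, let $\Omega=\{0,1\}^{\mathbb Z^d}$ carry the product $\sigma$-algebra, and embed $\mathbb Z^d$ in $\mathbb R^d$ with the Euclidean norm $\|\cdot\|$ and scalar product $\langle\cdot,\cdot\rangle$. For $f:\Omega\to\{0,1\}$ let $D_f:\Omega\to\Omega$ be given by $(D_f x)_i=f\bigl((x_{i+j})_{j\in\mathbb Z^d}\bigr)$. Call $f$ standard if it is local (it depends only on the coordinates in some finite $\Delta\subset\mathbb Z^d$), monotone for the coordinatewise order, and not constant. For standard $f$ and a direction $p\in\mathbb R^d$, $\|p\|=1$, the velocity $V_p$ is the unique real number such that for every $C\in\mathbb R$ the operator $D_f$ maps the configuration equal to $1$ exactly on $\{i\in\mathbb Z^d:\langle i,p\rangle\le C\}$ to the configuration equal to $1$ exactly on $\{i\in\mathbb Z^d:\langle i,p\rangle\le C+V_p\}$. A configuration $x$ attracts $D_f$ if $D_fx=x$ and for every $y$ that differs from $x$ at only finitely many sites there is a $t\in\mathbb N$ with $D_f^{\,t}y=x$. For $\varepsilon\in[0,1]$ the one-sided noise $N_\varepsilon$ maps $\delta_x$ to the product measure whose $i$-th coordinate equals $1$ with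 probability $1$ if $x_i=1$ and with probability $\varepsilon$ if $x_i=0$, and it maps a general probability measure $\mu$ to $\int N_\varepsilon\delta_x\,\mu(dx)$; a probability measure $\mu$ on $\Omega$ is invariant for $N_\varepsilon D_f$ if $N_\varepsilon(\mu\circ D_f^{-1})=\mu$. Theorem. Let $f$ be standard and such that "all ones" attracts $D_f$, and assume that one of the following holds: (a) $V_p+V_{-p}\ge 0$ for all directions $p$; (b) $V_p+V_{-p}>0$ for some direction $p$. Then for every $\varepsilon\in(0,1]$ and every invariant probability measure $\mu$ of $N_\varepsilon D_f$ there is a constant $C>0$ such that for all real $L\ge 1$ $$-\ln\mu\bigl(\{x\in\Omega: x_i=1\text{ for all } i\in\mathbb Z^d \text{ with } \|i\|\le L\}\bigr)\le C\,L^{d-1}$$ (in particular these probabilities are positive). Hence $\mu$ does not have the alignment-suppression property, i.e. it is not true that for every $z\in\Omega$ there is a $C>0$ such that $-\ln\mu(\{x: x_i=z_i,\ i\in\Lambda\})\ge C|\Lambda|$ for every finite $\Lambda\subset\mathbb Z^d$ (with $-\ln 0=+\infty$); and $\mu$ is not Gibbsian, i.e. it is not a Gibbs measure (a solution of the Dobrushin-Lanford-Ruelle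 equations in all finite volumes) for any uniformly absolutely summable interaction $(\Phi_A)_{A\subset\mathbb Z^d\text{ finite}}$, where $\Phi_A:\Omega\to\mathbb R$ depends only on the coordinates in $A$ and $\sup_i\sum_{A\ni i}\|\Phi_A\|_\infty<\infty$. -/

import Mathlib

open MeasureTheory ProbabilityTheory
open scoped ENNReal NNReal

namespace CellularAutomata

/-- The sites of the lattice `ℤ^d`. -/
abbrev Site (d : ℕ) : Type := Fin d → ℤ

/-- Configurations `{0,1}^{ℤ^d}`, with `true` for `1` and `false` for `0`, the coordinatewise
order and the product sigma-algebra (generated by the cylinder sets). -/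
abbrev Config (d : ℕ) : Type := Site d → Bool

/-- The embedding of `ℤ^d` in Euclidean space. -/
noncomputable def toSpace {d : ℕ} (i : Site d) : EuclideanSpace ℝ (Fin d) :=
  WithLp.toLp 2 fun k => (i k : ℝ)

open Classical in
/-- The configuration with indicator `S`. -/
noncomputable def conf {d : ℕ} (S : Set (Site d)) : Config d := fun i => decide (i ∈ S)

/-- The configuration "all ones". -/
def allOnes (d : ℕ) : Config d := fun _ => true

/-- The deterministic parallel updating with transition function `f`: the new value at `i` is
`f` applied to the configuration seen from `i`. -/
def update {d : ℕ} (f : Config d → Bool) (x : Config d) : Config d :=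
  fun i => f fun j => x (i + j)

/-- Standard transition functions: local, monotonic, not constant. -/
structure IsStandard {d : ℕ} (f : Config d → Bool) : Prop where
  isLocal : ∃ Δ : Finset (Site d), DependsOn f (Δ : Set (Site d))
  monotone : Monotone f
  nonconst : ∃ x y, f x ≠ f y

/-- `x` is an invariant configuration which attracts `D_f`: every finite deviation of `x`
becomes equal to `x` after some time. -/
def Attracts {d : ℕ} (f : Config d → Bool) (x : Config d) : Prop :=
  update f x = x ∧
    ∀ y : Config d, {i | y i ≠ x i}.Finite → ∃ t : ℕ, (update f)^[t] y = x

/-- The front `{i : ⟨i, p⟩ ≤ C}`. -/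
noncomputable def front {d : ℕ} (p : EuclideanSpace ℝ (Fin d)) (C : ℝ) : Config d :=
  conf {i | inner ℝ (toSpace i) p ≤ C}

/-- The velocity of `D_f` in the direction `p`: the number `V` such that `D_f` transforms the
front `⟨i, p⟩ ≤ C` into the front `⟨i, p⟩ ≤ C + V`, for every `C`. It exists and is unique when
`f` is standard, see `IsStandard.existsUnique_velocity`. -/
noncomputable def velocity {d : ℕ} (f : Config d → Bool) (p : EuclideanSpace ℝ (Fin d)) : ℝ :=
  Classical.epsilon fun V : ℝ => ∀ C : ℝ, update f (front p C) = front p (C + V)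

theorem front_apply {d : ℕ} (p : EuclideanSpace ℝ (Fin d)) (C : ℝ) (i : Site d) :
    front p C i = true ↔ inner ℝ (toSpace i) p ≤ C := by
  simp [front, conf]

theorem toSpace_add {d : ℕ} (i j : Site d) : toSpace (i + j) = toSpace i + toSpace j := by
  ext k; simp [toSpace]

theorem IsStandard.exists_threshold {d : ℕ} {f : Config d → Bool} (hf : IsStandard f)
    (p : EuclideanSpace ℝ (Fin d)) : ∃ c : ℝ, ∀ C : ℝ, f (front p C) = true ↔ c ≤ C := by
  classical
  obtain ⟨Δ, hΔ⟩ := hf.isLocal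
  have h_bot : f (fun _ => false) = false := by
    by_contra h
    obtain ⟨x, y, hxy⟩ := hf.nonconst
    have key : ∀ z, f z = true := fun z => by
      have := hf.monotone (show (fun _ => false : Config d) ≤ z from fun i => Bool.false_le _)
      revert this; cases hz : f z <;> simp_all [Bool.le_iff_imp]
    exact hxy (by rw [key, key])
  have h_top : f (fun _ => true) = true := by
    by_contra h
    obtain ⟨x, y, hxy⟩ := hf.nonconst
    have key : ∀ z, f z = false := fun z => by
      have := hf.monotone (show z ≤ (fun _ => true : Config d) from fun i => Bool.le_true _)
      revert this; cases hz : f z <;> simp_all [Bool.le_iff_imp]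
    exact hxy (by rw [key, key])
  set g : Site d → ℝ := fun j => inner ℝ (toSpace j) p with hg
  have h_mono : ∀ C C' : ℝ, C ≤ C' → f (front p C) = true → f (front p C') = true := by
    intro C C' h h1
    have hle : front p C ≤ front p C' := fun i => by
      rw [Bool.le_iff_imp, front_apply, front_apply]
      exact fun h2 => h2.trans h
    have := hf.monotone hle
    rw [h1] at this
    exact Bool.eq_true_of_true_le this
  set W : Finset ℝ := (Δ.image g).filter fun c => f (front p c) = true with hW
  have h_step : ∀ C : ℝ, f (front p C) = true → ∃ m ∈ W, m ≤ C := by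
    intro C hC
    have hne : (Δ.filter fun j => g j ≤ C).Nonempty := by
      by_contra hne
      rw [Finset.not_nonempty_iff_eq_empty, Finset.filter_eq_empty_iff] at hne
      have h0 : f (front p C) = f (fun _ => false) := hΔ fun j hj => by
        have := hne hj
        rw [Bool.eq_false_iff, ne_eq, front_apply]
        exact this
      rw [h0, h_bot] at hC
      exact absurd hC (by simp)
    obtain ⟨j, hj, hmax⟩ := Finset.exists_max_image _ g hne
    rw [Finset.mem_filter] at hj
    refine ⟨g j, ?_, hj.2⟩
    rw [hW, Finset.mem_filter]
    refine ⟨Finset.mem_image_of_mem g hj.1, ?_⟩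
    rw [← hC]
    refine hΔ fun k hk => ?_
    rw [Bool.eq_iff_iff, front_apply, front_apply]
    exact ⟨fun h => h.trans hj.2, fun h => hmax k (Finset.mem_filter.2 ⟨hk, h⟩)⟩
  have hWne : W.Nonempty := by
    obtain ⟨M, hM⟩ := (Δ.image g).finite_toSet.bddAbove
    have h1 : f (front p M) = true := by
      rw [← h_top]
      refine hΔ fun j hj => ?_
      rw [front_apply]
      exact hM (Finset.mem_coe.2 (Finset.mem_image_of_mem g hj))
    obtain ⟨m, hm, -⟩ := h_step M h1
    exact ⟨m, hm⟩
  refine ⟨W.min' hWne, fun C => ⟨fun h => ?_, fun h => ?_⟩⟩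
  · obtain ⟨m, hm, hmC⟩ := h_step C h
    exact (W.min'_le m hm).trans hmC
  · exact h_mono _ _ h (Finset.mem_filter.1 (W.min'_mem hWne)).2

theorem IsStandard.existsUnique_velocity {d : ℕ} {f : Config d → Bool} (hf : IsStandard f)
    (p : EuclideanSpace ℝ (Fin d)) :
    ∃! V : ℝ, ∀ C : ℝ, update f (front p C) = front p (C + V) := by
  obtain ⟨c, hc⟩ := hf.exists_threshold p
  refine ⟨-c, fun C => ?_, fun V hV => ?_⟩
  · funext i
    have h1 : (fun j => front p C (i + j)) = front p (C - inner ℝ (toSpace i) p) := by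
      funext j
      rw [Bool.eq_iff_iff, front_apply, front_apply, toSpace_add, inner_add_left]
      constructor <;> intro h <;> linarith
    rw [Bool.eq_iff_iff, front_apply, update, h1, hc]
    constructor <;> intro h <;> linarith
  · have h0 : ∀ C : ℝ, c ≤ C ↔ 0 ≤ C + V := fun C => by
      have h1 := congrFun (hV C) 0
      have h2 : (fun j => front p C (0 + j)) = front p C := by simp
      have h3 : toSpace (0 : Site d) = 0 := by ext k; simp [toSpace]
      rw [Bool.eq_iff_iff, update, h2, hc, front_apply, h3, inner_zero_left] at h1
      exact h1
    have h1 := (h0 c).1 le_rfl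
    have h2 := (h0 (-V)).2 (by simp)
    linarith

theorem IsStandard.update_front {d : ℕ} {f : Config d → Bool} (hf : IsStandard f)
    (p : EuclideanSpace ℝ (Fin d)) (C : ℝ) :
    update f (front p C) = front p (C + velocity f p) :=
  Classical.epsilon_spec (hf.existsUnique_velocity p).exists C

/-- The law of one coordinate after the noise: a `1` stays, a `0` becomes `1` with
probability `ε`. -/
noncomputable def siteNoise (ε : unitInterval) (b : Bool) : Measure Bool :=
  if b then Measure.dirac true
  else ENNReal.ofReal ε • Measure.dirac true + ENNReal.ofReal (1 - ε) • Measure.dirac false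

instance (ε : unitInterval) (b : Bool) : IsProbabilityMeasure (siteNoise ε b) := by
  cases b
  · constructor
    simp only [siteNoise, Bool.false_eq_true, if_false, Measure.add_apply, Measure.smul_apply,
      measure_univ, smul_eq_mul, mul_one]
    rw [← ENNReal.ofReal_add ε.2.1 (sub_nonneg.2 ε.2.2)]
    simp
  · simp only [siteNoise, if_true]
    infer_instance

/-- The one-sided noise as a Markov kernel: `x` is sent to the product measure `N_ε δ_x`. -/
noncomputable def noiseKernel (d : ℕ) (ε : unitInterval) : Kernel (Config d) (Config d) where
  toFun x := Measure.infinitePi fun i => siteNoise ε (x i)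
  measurable' := by
    refine Measurable.measure_of_isPiSystem_of_isProbabilityMeasure
      (generateFrom_measurableCylinders (α := fun _ : Site d => Bool)).symm
      isPiSystem_measurableCylinders fun s hs => ?_
    obtain ⟨I, S, hS, rfl⟩ := (mem_measurableCylinders s).1 hs
    have h1 : ∀ x : Config d, (Measure.infinitePi fun i => siteNoise ε (x i)) (cylinder I S) =
        (Measure.pi fun i : I => siteNoise ε (I.restrict x i)) S := fun x => by
      rw [cylinder, ← Measure.map_apply (Finset.measurable_restrict I) hS,
        Measure.infinitePi_map_restrict]
      rfl
    simp only [h1]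
    exact (measurable_of_countable
      (fun y : I → Bool => (Measure.pi fun i : I => siteNoise ε (y i)) S)).comp
      (Finset.measurable_restrict I)

/-- The one-sided noise `N_ε` acting on measures. -/
noncomputable def noise {d : ℕ} (ε : unitInterval) (μ : Measure (Config d)) :
    Measure (Config d) :=
  μ.bind (noiseKernel d ε)

/-- `μ` is an invariant probability measure of `N_ε D_f`. -/
def IsInvariantMeasure {d : ℕ} (f : Config d → Bool) (ε : unitInterval)
    (μ : Measure (Config d)) : Prop :=
  IsProbabilityMeasure μ ∧ noise ε (μ.map (update f)) = μ

theorem IsStandard.measurable_update {d : ℕ} {f : Config d → Bool} (hf : IsStandard f) :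
    Measurable (update f) := by
  obtain ⟨Δ, hΔ⟩ := hf.isLocal
  obtain ⟨g, hg⟩ := (dependsOn_iff_exists_comp).1 hΔ
  have hfm : Measurable f := by
    rw [hg]
    exact (measurable_of_countable (fun y : (↥(Δ : Set (Site d))) → Bool => g y)).comp
      (measurable_pi_lambda _ fun i => measurable_pi_apply _)
  refine measurable_pi_lambda _ fun i => hfm.comp ?_
  exact measurable_pi_lambda _ fun j => measurable_pi_apply _

/-- The set of configurations which agree with `z` on `Λ`. -/
def agreeOn {d : ℕ} (z : Config d) (Λ : Set (Site d)) : Set (Config d) :=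
  {x | ∀ i ∈ Λ, x i = z i}

/-- The (full) sphere in `ℤ^d` with center the origin and radius `L`. -/
def sphere (d : ℕ) (L : ℝ) : Set (Site d) := {i | ‖toSpace i‖ ≤ L}

/-- The alignment-suppression property: for every configuration `z` there is a `C > 0` such
that `-ln μ(z_Λ) ≥ C |Λ|` for every finite `Λ` (where `-ln 0 = +∞`). -/
def HasASP {d : ℕ} (μ : Measure (Config d)) : Prop :=
  ∀ z : Config d, ∃ C : ℝ, 0 < C ∧ ∀ Λ : Finset (Site d),
    ((C * (Λ.card : ℝ) : ℝ) : EReal) ≤ -ENNReal.log (μ (agreeOn z Λ))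

/-- A uniformly absolutely summable interaction on `ℤ^d`: `Φ A` depends only on the spins in
`A`, and `∑_{A ∋ i} ‖Φ A‖_∞` is bounded uniformly in the site `i`. -/
structure Interaction (d : ℕ) where
  Φ : Finset (Site d) → Config d → ℝ
  dependsOn : ∀ A, DependsOn (Φ A) (A : Set (Site d))
  summable : ∃ K : ℝ≥0, ∀ i : Site d,
    ∑' A : {A : Finset (Site d) // i ∈ A}, ⨆ ω : Config d, ‖Φ A ω‖ₑ ≤ K

namespace Interaction

/-- The energy in `Λ`: the sum of `Φ A ω` over all `A` which meet `Λ`. -/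
noncomputable def energy {d : ℕ} (I : Interaction d) (Λ : Finset (Site d)) (ω : Config d) : ℝ :=
  ∑' A : {A : Finset (Site d) // ¬ Disjoint A Λ}, I.Φ A ω

end Interaction

open Classical in
/-- The configuration equal to `σ` in `Λ` and to `ω` outside `Λ`. -/
noncomputable def patch {d : ℕ} (Λ : Finset (Site d)) (σ : Λ → Bool) (ω : Config d) :
    Config d :=
  fun i => if h : i ∈ Λ then σ ⟨i, h⟩ else ω i

namespace Interaction

open Classical in
/-- The Boltzmann-Gibbs probability of `σ` in `Λ` with the external condition `ω` (the inverse
temperature is part of the interaction). -/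
noncomputable def gibbsWeight {d : ℕ} (I : Interaction d) (Λ : Finset (Site d)) (σ : Λ → Bool)
    (ω : Config d) : ℝ :=
  Real.exp (-I.energy Λ (patch Λ σ ω)) /
    ∑ τ : Λ → Bool, Real.exp (-I.energy Λ (patch Λ τ ω))

open Classical in
/-- `μ` is a Gibbs measure for the interaction: a probability measure which satisfies the
Dobrushin-Lanford-Ruelle equations in all finite volumes. -/
def IsGibbsMeasure {d : ℕ} (I : Interaction d) (μ : Measure (Config d)) : Prop :=
  IsProbabilityMeasure μ ∧
    ∀ (Λ : Finset (Site d)) (B : Set (Config d)), MeasurableSet B →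
      μ B = ∫⁻ ω, ∑ σ : Λ → Bool,
        ENNReal.ofReal (I.gibbsWeight Λ σ ω) * B.indicator 1 (patch Λ σ ω) ∂μ

end Interaction

/-- `μ` is Gibbsian: it is a Gibbs measure for some uniformly absolutely summable
interaction. -/
def IsGibbsian {d : ℕ} (μ : Measure (Config d)) : Prop :=
  ∃ I : Interaction d, I.IsGibbsMeasure μ

end CellularAutomata

namespace CellularAutomata

/-! The noise only adds ones and $D_f$ is monotone, so an invariant $\mu$ satisfies
$\mu(D_f^{-T}A)\le\mu(A)$ for every increasing event $A$. The noise also makes any finite set $S$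
all ones with probability at least $\varepsilon^{|S|}$. If $D_f^T$ sends the indicator of $S$ to a
configuration that is one on the ball of radius $L$, then that ball is all ones with probability at
least $\varepsilon^{|S|}$ (`IsInvariantMeasure.pow_card_le`). It remains to find such a seed with
$|S|=O(L^{d-1})$.

The seeds are pieces of slabs of width $2r$, where $r$ bounds the range; such a slab moves with the
velocities of its two faces. If $V_p+V_{-p}>0$, one slab grows linearly and covers the ball in time
$O(L)$ (`IsStandard.exists_seed_of_pos`). If only $V_p+V_{-p}\ge0$ for all $p$, slabs persist. A
grid of slabs with spacing $L$ in finitely many directions then encloses islands of zeros of size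
$O(L)$, and these must be erased in time $O(L)$ (`IsStandard.exists_seed_of_attracts`).

Linear-time erasure holds because no vector $v$ satisfies $V_q\le\langle v,q\rangle$ for all $q$
(`IsStandard.exists_inner_lt_velocity`); compactness then selects the directions. Such a $v$ would
force $V_q=\langle v,q\rangle$ with $v=-a_0$ for a site $a_0$ of the neighbourhood, and every set of
ones that forces a one would have $a_0$ in its convex hull. Integer relations among its sites would
then give a finite island of zeros that only translates (`not_attracts_allOnes`).

For a Gibbs measure each spin value has conditional probability at most some $q<1$, so a pattern on
$\Lambda$ has probability at most $q^{|\Lambda|}$. This is incompatible with a cost $O(L^{d-1})$ on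
order $L^d$ sites. -/

/-! ### Fronts, range and velocities -/

theorem conf_apply {d : ℕ} (S : Set (Site d)) (i : Site d) : conf S i = true ↔ i ∈ S := by
  simp [conf]

theorem config_le_iff {d : ℕ} {x y : Config d} : x ≤ y ↔ ∀ i, x i = true → y i = true := by
  simp [Pi.le_def, Bool.le_iff_imp]

theorem IsStandard.monotone_update {d : ℕ} {f : Config d → Bool} (hf : IsStandard f) :
    Monotone (update f) := fun _ _ h _ => hf.monotone fun _ => h _

theorem IsStandard.apply_true_of_le {d : ℕ} {f : Config d → Bool} (hf : IsStandard f)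
    {x y : Config d} (h : ∀ i, x i = true → y i = true) (hx : f x = true) : f y = true :=
  Bool.le_iff_imp.1 (hf.monotone (config_le_iff.2 h)) hx

theorem IsStandard.apply_false {d : ℕ} {f : Config d → Bool} (hf : IsStandard f) :
    f (fun _ => false) = false := by
  by_contra h
  obtain ⟨x, y, hxy⟩ := hf.nonconst
  have key : ∀ z, f z = true := fun z =>
    hf.apply_true_of_le (x := fun _ => false) (by simp) (by simpa using h)
  exact hxy (by rw [key, key])

/-- `f` has interaction range at most `r`, witnessed by the neighbourhood `Δ`. -/
structure HasRange {d : ℕ} (f : Config d → Bool) (Δ : Finset (Site d)) (r : ℝ) : Prop where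
  dependsOn : DependsOn f (Δ : Set (Site d))
  nonneg : 0 ≤ r
  norm_le : ∀ a ∈ Δ, ‖toSpace a‖ ≤ r

theorem IsStandard.exists_range {d : ℕ} {f : Config d → Bool} (hf : IsStandard f) :
    ∃ Δ r, HasRange f Δ r := by
  obtain ⟨Δ, hΔ⟩ := hf.isLocal
  refine ⟨Δ, ∑ a ∈ Δ, ‖toSpace a‖, hΔ, by positivity, fun a ha => ?_⟩
  exact Finset.single_le_sum (f := fun a => ‖toSpace a‖) (fun _ _ => norm_nonneg _) ha

theorem HasRange.abs_inner_le {d : ℕ} {f : Config d → Bool} {Δ : Finset (Site d)} {r : ℝ}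
    (hr : HasRange f Δ r) {p : EuclideanSpace ℝ (Fin d)} (hp : ‖p‖ = 1) {a : Site d}
    (ha : a ∈ Δ) : |inner ℝ (toSpace a) p| ≤ r := by
  have := abs_real_inner_le_norm (toSpace a) p
  rw [hp, mul_one] at this
  exact this.trans (hr.norm_le a ha)

theorem IsStandard.apply_front {d : ℕ} {f : Config d → Bool} (hf : IsStandard f)
    (p : EuclideanSpace ℝ (Fin d)) (C : ℝ) :
    f (front p C) = true ↔ 0 ≤ C + velocity f p := by
  have h1 := congrFun (hf.update_front p C) 0
  have h3 : toSpace (0 : Site d) = 0 := by ext k; simp [toSpace]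
  rw [Bool.eq_iff_iff, front_apply, h3, inner_zero_left] at h1
  simpa [update] using h1

/-- Among the sites of `Δ`, a front changes only at levels $\langle a,p\rangle$, so the threshold
$-V_p$ is one of these. Besides bounding $V_p$, this makes a linear velocity rigid. -/
theorem IsStandard.exists_velocity_eq {d : ℕ} {f : Config d → Bool} (hf : IsStandard f)
    {Δ : Finset (Site d)} (hΔ : DependsOn f (Δ : Set (Site d)))
    (p : EuclideanSpace ℝ (Fin d)) : ∃ a ∈ Δ, velocity f p = -inner ℝ (toSpace a) p := by
  set g : Site d → ℝ := fun j => inner ℝ (toSpace j) p with hg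
  have hc : f (front p (-velocity f p)) = true := (hf.apply_front p _).2 (by simp)
  have hne : (Δ.filter fun j => g j ≤ -velocity f p).Nonempty := by
    by_contra hne
    rw [Finset.not_nonempty_iff_eq_empty, Finset.filter_eq_empty_iff] at hne
    have h0 : f (front p (-velocity f p)) = f (fun _ => false) := hΔ fun j hj => by
      rw [Bool.eq_false_iff, ne_eq, front_apply]
      exact hne hj
    rw [h0, hf.apply_false] at hc
    exact absurd hc (by simp)
  obtain ⟨a, ha, hmax⟩ := Finset.exists_max_image _ g hne
  rw [Finset.mem_filter] at ha
  refine ⟨a, ha.1, ?_⟩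
  have h1 : f (front p (g a)) = true := by
    rw [← hc]
    refine hΔ fun k hk => ?_
    rw [Bool.eq_iff_iff, front_apply, front_apply]
    exact ⟨fun h => h.trans ha.2, fun h => hmax k (Finset.mem_filter.2 ⟨hk, h⟩)⟩
  have h2 := (hf.apply_front p _).1 h1
  have h3 := ha.2
  simp only [hg] at h2 h3
  linarith

theorem IsStandard.abs_velocity_le {d : ℕ} {f : Config d → Bool} (hf : IsStandard f)
    {Δ : Finset (Site d)} {r : ℝ} (hr : HasRange f Δ r)
    {p : EuclideanSpace ℝ (Fin d)} (hp : ‖p‖ = 1) : |velocity f p| ≤ r := by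
  obtain ⟨a, ha, h⟩ := hf.exists_velocity_eq hr.dependsOn p
  rw [h, abs_neg]
  exact hr.abs_inner_le hp ha

theorem IsStandard.iterate_update_front {d : ℕ} {f : Config d → Bool} (hf : IsStandard f)
    (p : EuclideanSpace ℝ (Fin d)) (C : ℝ) (t : ℕ) :
    (update f)^[t] (front p C) = front p (C + t * velocity f p) := by
  induction t with
  | zero => simp
  | succ t ih =>
    rw [Function.iterate_succ_apply', ih, hf.update_front]
    push_cast
    ring_nf

/-! ### Finite propagation and slabs -/

/-- The pointwise minimum of `x` and `y` agrees with `x` on the neighbourhood of `i` and lies below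
`y` everywhere, so comparison is needed only locally. -/
theorem IsStandard.update_apply_of_ge {d : ℕ} {f : Config d → Bool} (hf : IsStandard f)
    {Δ : Finset (Site d)} (hΔ : DependsOn f (Δ : Set (Site d))) {x y : Config d} {i : Site d}
    (h : ∀ a ∈ Δ, x (i + a) = true → y (i + a) = true) (hx : update f x i = true) :
    update f y i = true := by
  have h1 : f (fun j => x (i + j) && y (i + j)) = true := by
    rw [← hx]
    refine hΔ fun a ha => ?_
    have := h a ha
    cases hxa : x (i + a) <;> simp_all
  exact hf.apply_true_of_le (by simp) h1

theorem HasRange.iterate_update_congr {d : ℕ} {f : Config d → Bool}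
    {Δ : Finset (Site d)} {r : ℝ} (hr : HasRange f Δ r) {x y : Config d} (T : ℕ) :
    ∀ i : Site d, (∀ j, ‖toSpace j‖ ≤ ‖toSpace i‖ + T * r → x j = y j) →
      (update f)^[T] x i = (update f)^[T] y i := by
  induction T with
  | zero => intro i h; simpa using h i (by simp)
  | succ T ih =>
    intro i h
    rw [Function.iterate_succ_apply', Function.iterate_succ_apply']
    refine hr.dependsOn fun a ha => ih _ fun j hj => h j ?_
    have h1 := hr.norm_le a ha
    have h2 := norm_add_le (toSpace i) (toSpace a)
    rw [toSpace_add] at hj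
    push_cast
    linarith

/-- With width at least `2 * r`, a site on either side of the middle is too far from the opposite
face to see it: its neighbourhood looks like a half-space. -/
theorem IsStandard.update_slab {d : ℕ} {f : Config d → Bool} (hf : IsStandard f)
    {Δ : Finset (Site d)} {r : ℝ} (hr : HasRange f Δ r)
    {p : EuclideanSpace ℝ (Fin d)} (hp : ‖p‖ = 1) {α β : ℝ} (hαβ : 2 * r ≤ β - α)
    {x : Config d}
    (hx : ∀ i, α ≤ inner ℝ (toSpace i) p → inner ℝ (toSpace i) p ≤ β → x i = true)
    {i : Site d} (hi : α - velocity f (-p) ≤ inner ℝ (toSpace i) p)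
    (hi' : inner ℝ (toSpace i) p ≤ β + velocity f p) : update f x i = true := by
  rcases le_total ((α + β) / 2) (inner ℝ (toSpace i) p) with h | h
  · refine hf.update_apply_of_ge (x := front p β) hr.dependsOn (fun a ha h1 => hx _ ?_ ?_) ?_
    · have := abs_le.1 (hr.abs_inner_le hp ha)
      rw [toSpace_add, inner_add_left]
      linarith
    · exact (front_apply _ _ _).1 h1
    · rw [hf.update_front, front_apply]
      exact hi'
  · refine hf.update_apply_of_ge (x := front (-p) (-α)) hr.dependsOn
      (fun a ha h1 => hx _ ?_ ?_) ?_
    · rw [front_apply, inner_neg_right] at h1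
      linarith
    · have := abs_le.1 (hr.abs_inner_le hp ha)
      rw [toSpace_add, inner_add_left]
      linarith
    · rw [hf.update_front, front_apply, inner_neg_right]
      linarith

/-- Since $V_p+V_{-p}\ge0$, the width never drops below `2 * r` and the one-step estimate can be
repeated. -/
theorem IsStandard.iterate_update_slab {d : ℕ} {f : Config d → Bool} (hf : IsStandard f)
    {Δ : Finset (Site d)} {r : ℝ} (hr : HasRange f Δ r)
    {p : EuclideanSpace ℝ (Fin d)} (hp : ‖p‖ = 1)
    (hV : 0 ≤ velocity f p + velocity f (-p)) {α β : ℝ} (hαβ : 2 * r ≤ β - α)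
    {x : Config d}
    (hx : ∀ i, α ≤ inner ℝ (toSpace i) p → inner ℝ (toSpace i) p ≤ β → x i = true) (t : ℕ) :
    ∀ i : Site d, α - t * velocity f (-p) ≤ inner ℝ (toSpace i) p →
      inner ℝ (toSpace i) p ≤ β + t * velocity f p → (update f)^[t] x i = true := by
  induction t with
  | zero => simpa using hx
  | succ t ih =>
    intro i hi hi'
    rw [Function.iterate_succ_apply']
    push_cast at hi hi'
    have : 0 ≤ t * (velocity f p + velocity f (-p)) := by positivity
    exact hf.update_slab hr hp (by linarith) ih (by linarith) (by linarith)

/-! ### Erasing the cells of a grid of slabs -/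

/-- Parallel slabs of ones in finitely many directions fill the whole lattice, if in these
directions an island of zeros of linear size `ℓ` is erased in time `T`. -/
theorem IsStandard.iterate_update_slabs_eq_allOnes {d : ℕ} {f : Config d → Bool}
    (hf : IsStandard f) {Δ : Finset (Site d)} {r : ℝ} (hr : HasRange f Δ r)
    (hfix : update f (allOnes d) = allOnes d)
    {P : Finset (EuclideanSpace ℝ (Fin d))} (hP : ∀ p ∈ P, ‖p‖ = 1)
    (hV : ∀ p ∈ P, 0 ≤ velocity f p + velocity f (-p)) {δ : ℝ}
    (hδ : ∀ x : EuclideanSpace ℝ (Fin d), ∃ p ∈ P, δ - velocity f (-p) < inner ℝ x p)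
    {ℓ : ℝ} (hℓ : 0 < ℓ) {T : ℕ} (hT : 0 < T) (hTδ : ℓ ≤ T * δ) {x : Config d}
    (hx : ∀ i, ∀ p ∈ P, ∀ k : ℤ, k * ℓ ≤ inner ℝ (toSpace i) p →
      inner ℝ (toSpace i) p ≤ k * ℓ + 2 * r → x i = true) (i : Site d) :
    (update f)^[T] x i = true := by
  have hslab : ∀ p ∈ P, ∀ k : ℤ, ∀ t : ℕ, ∀ i : Site d,
      k * ℓ - t * velocity f (-p) ≤ inner ℝ (toSpace i) p →
      inner ℝ (toSpace i) p ≤ k * ℓ + 2 * r + t * velocity f p → (update f)^[t] x i = true :=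
    fun p hp k t => hf.iterate_update_slab hr (hP p hp) (hV p hp) (by linarith)
      (fun i => hx i p hp k) t
  have hsum : ∀ p ∈ P, ∀ t : ℕ, 0 ≤ t * velocity f p + t * velocity f (-p) := fun p hp t => by
    have := mul_nonneg (Nat.cast_nonneg (α := ℝ) t) (hV p hp)
    linarith
  have hvel : ∀ p ∈ P, |velocity f p| ≤ r := fun p hp => hf.abs_velocity_le hr (hP p hp)
  have hvel' : ∀ p ∈ P, |velocity f (-p)| ≤ r := fun p hp =>
    hf.abs_velocity_le hr (by rw [norm_neg, hP p hp])
  have hr0 := hr.nonneg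
  -- In each direction, `k - 1` and `k` index the slabs between whose outer faces `i` lies at time
  -- `T`.
  have hκ : ∀ p, ∃ k : ℤ, p ∈ P → (k - 1) * ℓ - T * velocity f (-p) ≤ inner ℝ (toSpace i) p ∧
      inner ℝ (toSpace i) p ≤ k * ℓ + 2 * r + T * velocity f p := by
    intro p
    refine ⟨⌈(inner ℝ (toSpace i) p + T * velocity f (-p)) / ℓ⌉, fun hp => ⟨?_, ?_⟩⟩
    · have h1 := Int.ceil_lt_add_one ((inner ℝ (toSpace i) p + T * velocity f (-p)) / ℓ)
      have h2 := mul_lt_mul_of_pos_right h1 hℓ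
      rw [add_mul, div_mul_cancel₀ _ hℓ.ne'] at h2
      linarith
    · have h1 := Int.le_ceil ((inner ℝ (toSpace i) p + T * velocity f (-p)) / ℓ)
      have h2 := mul_le_mul_of_nonneg_right h1 hℓ.le
      rw [div_mul_cancel₀ _ hℓ.ne'] at h2
      have := hsum p hp T
      linarith
  choose κ hκ using hκ
  -- Comparison configuration: its only zeros are in the single open cell enclosed by the chosen
  -- slabs.
  set y : Config d := conf {i | ¬ ∀ p ∈ P, (κ p - 1) * ℓ + 2 * r < inner ℝ (toSpace i) p ∧
    inner ℝ (toSpace i) p < κ p * ℓ} with hy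
  -- The half-spaces beyond the cell consist of ones. Applying `hδ` to the mean velocity from a cell
  -- site to `j` yields one that has reached `j` by time `T`, because `ℓ ≤ T * δ`.
  have hyT : ∀ j, (update f)^[T] y j = true := by
    intro j
    by_cases hcell : ∃ i₀ : Site d, ∀ p ∈ P, (κ p - 1) * ℓ + 2 * r < inner ℝ (toSpace i₀) p ∧
        inner ℝ (toSpace i₀) p < κ p * ℓ
    · obtain ⟨i₀, hi₀⟩ := hcell
      have hT' : (0 : ℝ) < T := by exact_mod_cast hT
      obtain ⟨p, hp, h1⟩ := hδ ((T : ℝ)⁻¹ • (toSpace j - toSpace i₀))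
      rw [inner_smul_left, inner_sub_left] at h1
      have h2 := mul_lt_mul_of_pos_left h1 hT'
      simp only [map_inv₀, conj_trivial] at h2
      rw [mul_inv_cancel_left₀ hT'.ne'] at h2
      have h3 : front (-p) (-(κ p * ℓ)) ≤ y := config_le_iff.2 fun i hi => by
        rw [front_apply, inner_neg_right] at hi
        rw [hy, conf_apply]
        intro h
        have := (h p hp).2
        linarith
      refine config_le_iff.1 (hf.monotone_update.iterate T h3) j ?_
      rw [hf.iterate_update_front, front_apply, inner_neg_right]
      have := (hi₀ p hp).1
      linarith
    · have : y = allOnes d := by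
        funext i
        rw [allOnes, hy, conf_apply]
        exact fun h => hcell ⟨i, h⟩
      rw [this, Function.iterate_fixed hfix]
      rfl
  -- Between the outer faces `x` dominates `y`: a site is either in a persisting slab, or so far
  -- inside that its whole neighbourhood was between the outer faces one step earlier.
  have key : ∀ t : ℕ, ∀ i : Site d, (∀ p ∈ P,
      (κ p - 1) * ℓ - t * velocity f (-p) ≤ inner ℝ (toSpace i) p ∧
      inner ℝ (toSpace i) p ≤ κ p * ℓ + 2 * r + t * velocity f p) →
      (update f)^[t] y i = true → (update f)^[t] x i = true := by
    intro t
    induction t with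
    | zero =>
      intro i hi h
      rw [Function.iterate_zero, id, hy, conf_apply, Set.mem_ofPred_eq] at h
      push Not at h
      obtain ⟨p, hp, h⟩ := h
      have h1 := hi p hp
      simp only [Nat.cast_zero, zero_mul, sub_zero, add_zero] at h1
      by_cases h2 : (κ p - 1) * ℓ + 2 * r < inner ℝ (toSpace i) p
      · exact hx i p hp (κ p) (h h2) h1.2
      · refine hx i p hp (κ p - 1) ?_ ?_
        · push_cast; exact h1.1
        · push_cast; exact not_lt.1 h2
    | succ t ih =>
      intro i hi h
      by_cases hin : ∃ p ∈ P, inner ℝ (toSpace i) p ≤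
          (κ p - 1) * ℓ + 2 * r + (t + 1) * velocity f p ∨
          κ p * ℓ - (t + 1) * velocity f (-p) ≤ inner ℝ (toSpace i) p
      · obtain ⟨p, hp, h1 | h1⟩ := hin
        · refine hslab p hp (κ p - 1) (t + 1) i ?_ ?_
          · have := (hi p hp).1
            push_cast at this ⊢
            exact this
          · push_cast
            exact h1
        · refine hslab p hp (κ p) (t + 1) i ?_ (hi p hp).2
          push_cast
          exact h1
      · push Not at hin
        rw [Function.iterate_succ_apply'] at h ⊢
        refine hf.update_apply_of_ge hr.dependsOn (fun a ha => ih _ fun p hp => ?_) h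
        rw [toSpace_add, inner_add_left]
        have h1 := hin p hp
        have h2 := abs_le.1 (hr.abs_inner_le (hP p hp) ha)
        have h3 := hsum p hp t
        have h4 := abs_le.1 (hvel p hp)
        have h5 := abs_le.1 (hvel' p hp)
        constructor <;> linarith
  exact key T i (fun p hp => hκ p hp) (hyT i)

/-! ### Islands of zeros that survive forever -/

theorem toSpace_injective {d : ℕ} : Function.Injective (toSpace (d := d)) := fun i j h => by
  funext k
  have := congrArg (fun x : EuclideanSpace ℝ (Fin d) => x k) h
  simpa [toSpace] using this

/-- A lattice point in the convex hull of finitely many lattice points is a barycenter of them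
with integer weights. -/
theorem exists_nat_weights {d : ℕ} {A : Finset (Site d)} {a₀ : Site d}
    (h : toSpace a₀ ∈ convexHull ℝ (toSpace '' (A : Set (Site d)))) :
    ∃ n : Site d → ℕ, (∃ a ∈ A, n a ≠ 0) ∧ ∑ a ∈ A, n a • (a - a₀) = 0 := by
  classical
  rw [← Finset.coe_image, Finset.mem_convexHull'] at h
  obtain ⟨w, hw0, hw1, hw⟩ := h
  rw [Finset.sum_image toSpace_injective.injOn] at hw1 hw
  set c : Site d → ℝ := fun a => w (toSpace a) with hc
  have hc0 : ∀ a ∈ A, 0 ≤ c a := fun a ha => hw0 _ (Finset.mem_image_of_mem _ ha)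
  have hck : ∀ k, ∑ a ∈ A, c a * ((a k : ℝ) - a₀ k) = 0 := by
    intro k
    have h1 := congrArg (fun x : EuclideanSpace ℝ (Fin d) => x k) hw
    simp only [toSpace, WithLp.ofLp_sum, Finset.sum_apply, smul_eq_mul,
      WithLp.ofLp_smul, Pi.smul_apply] at h1
    simp only [mul_sub, Finset.sum_sub_distrib, ← Finset.sum_mul]
    rw [show ∑ a ∈ A, c a = 1 from hw1, one_mul, sub_eq_zero]
    exact h1
  obtain ⟨b, hb, hb0⟩ : ∃ b ∈ A, 0 < c b := by
    by_contra! hcon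
    have : ∑ a ∈ A, c a ≤ 0 := Finset.sum_nonpos hcon
    have h1 : ∑ a ∈ A, c a = 1 := hw1
    linarith
  -- The factor `Q` makes the rounded multiple of `c b` grow by at least one with each `m`, so the
  -- final weights are not all zero.
  obtain ⟨Q, hQ⟩ := exists_nat_gt (c b)⁻¹
  have hQb : 1 ≤ Q * c b := by
    rw [inv_eq_one_div, div_lt_iff₀ hb0] at hQ
    exact hQ.le
  -- The real relation has value zero, so rounding its multiples leaves integer vectors `s m` in a
  -- fixed box. By pigeonhole two of them coincide, and the difference of their weights is an
  -- integer relation.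
  set N : ℕ → Site d → ℕ := fun m a => ⌊((m * Q : ℕ) : ℝ) * c a⌋₊ with hN
  set s : ℕ → Site d := fun m => ∑ a ∈ A, N m a • (a - a₀) with hs
  set M : Site d := fun k => ∑ a ∈ A, |a k - a₀ k| with hM
  have hmem : ∀ m, s m ∈ Set.Icc (-M) M := by
    intro m
    have key : ∀ k, |s m k| ≤ M k := by
      intro k
      have h1 : (s m k : ℝ) = ∑ a ∈ A, ((N m a : ℝ) - ((m * Q : ℕ) : ℝ) * c a) *
          ((a k : ℝ) - a₀ k) := by
        simp only [sub_mul _ _ ((_ : ℝ) - _), Finset.sum_sub_distrib, mul_assoc,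
          ← Finset.mul_sum]
        rw [hck k, mul_zero, sub_zero]
        simp [hs]
      have h2 : |(s m k : ℝ)| ≤ M k := by
        rw [h1]
        refine (Finset.abs_sum_le_sum_abs _ _).trans ?_
        simp only [hM]
        push_cast
        refine Finset.sum_le_sum fun a ha => ?_
        rw [abs_mul]
        refine mul_le_of_le_one_left (abs_nonneg _) ?_
        have h3 : 0 ≤ ((m * Q : ℕ) : ℝ) * c a := mul_nonneg (Nat.cast_nonneg _) (hc0 a ha)
        have h4 := Nat.floor_le h3
        have h5 := Nat.lt_floor_add_one (((m * Q : ℕ) : ℝ) * c a)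
        simp only [hN]
        push_cast at h4 h5 ⊢
        rw [abs_le]
        constructor <;> linarith
      exact_mod_cast h2
    exact ⟨fun k => (abs_le.1 (key k)).1, fun k => (abs_le.1 (key k)).2⟩
  obtain ⟨m, m', hlt, heq⟩ := Set.Finite.exists_lt_map_eq_of_forall_mem hmem (Set.finite_Icc _ _)
  have hmono : ∀ a ∈ A, N m a ≤ N m' a := fun a ha => Nat.floor_le_floor
    (mul_le_mul_of_nonneg_right (by exact_mod_cast Nat.mul_le_mul_right Q hlt.le) (hc0 a ha))
  refine ⟨fun a => N m' a - N m a, ⟨b, hb, ?_⟩, ?_⟩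
  · have h1 : ((m * Q : ℕ) : ℝ) * c b + 1 ≤ ((m' * Q : ℕ) : ℝ) * c b := by
      have h2 : ((m : ℝ) + 1) * (Q * c b) ≤ m' * (Q * c b) :=
        mul_le_mul_of_nonneg_right (by exact_mod_cast hlt) (by linarith)
      push_cast
      linarith
    have h2 := Nat.floor_le_floor h1
    rw [Nat.floor_add_one (mul_nonneg (Nat.cast_nonneg _) hb0.le)] at h2
    simp only [hN]
    omega
  · have : ∑ a ∈ A, (N m' a - N m a) • (a - a₀) = s m' - s m := by
      simp only [hs, ← Finset.sum_sub_distrib]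
      exact Finset.sum_congr rfl fun a ha =>
        (sub_nsmul _ (hmono a ha)).trans (sub_eq_add_neg _ _).symm
    rw [this, heq, sub_self]

/-- If every set of ones which forces a one has `a₀` in its convex hull, then there is a finite
island of zeros which is never erased. -/
theorem not_attracts_allOnes {d : ℕ} {f : Config d → Bool}
    {Δ : Finset (Site d)} (hΔ : DependsOn f (Δ : Set (Site d))) {a₀ : Site d}
    (h : ∀ A : Finset (Site d), f (conf A) = true →
      toSpace a₀ ∈ convexHull ℝ (toSpace '' (A : Set (Site d)))) :
    ¬ Attracts f (allOnes d) := by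
  classical
  let ι := {A : Finset (Site d) //
    A ∈ Δ.powerset.filter fun A : Finset (Site d) => f (conf (A : Set (Site d))) = true}
  have hι : ∀ A : ι, f (conf A.1) = true := fun A => (Finset.mem_filter.1 A.2).2
  have hιΔ : ∀ A : ι, A.1 ⊆ Δ := fun A => Finset.mem_powerset.1 (Finset.mem_filter.1 A.2).1
  choose n hn hn0 using fun A : ι => exists_nat_weights (h A.1 (hι A))
  let N : ι × Δ → ℕ := fun x => if x.2.1 ∈ x.1.1 then n x.1 x.2 else 0
  let S : (ι × Δ → ℕ) → Site d := fun c => ∑ x, c x • (x.2.1 - a₀)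
  have hN0 : ∀ A : ι, ∑ a : Δ, N (A, a) • (a.1 - a₀) = 0 := by
    intro A
    rw [← hn0 A]
    simp only [N, ite_smul, zero_smul]
    rw [Finset.sum_coe_sort Δ (fun a => if a ∈ A.1 then n A a • (a - a₀) else 0),
      Finset.sum_ite_mem, Finset.inter_eq_right.2 (hιΔ A)]
  have hSadd : ∀ c x, S (c + Pi.single x 1) = S c + (x.2.1 - a₀) := by
    intro c x
    simp only [S, Pi.add_apply, add_smul, Finset.sum_add_distrib, Pi.single_apply, ite_smul,
      one_smul, zero_smul]
    refine congrArg _ ?_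
    rw [Finset.sum_eq_single x (fun b _ hb => if_neg hb) (by simp), if_pos rfl]
  -- The island is the set of endpoints of walks with steps `a - a₀`, in which each pair `(A, a)` is
  -- used at most `N (A, a)` times.
  set B : Set (Site d) := S '' Set.Iic N with hB
  have hBfin : B.Finite := (Set.finite_Iic N).image _
  have hadd_le : ∀ c ≤ N, ∀ x, c x < N x → c + Pi.single x 1 ≤ N := by
    intro c hc x hx z
    by_cases hz : z = x
    · subst hz; simpa using hx
    · simpa [hz] using hc z
  -- If a counter of `A` is not full, increase it. If all are full, their total displacement is
  -- zero, so they can be reset to zero without moving the endpoint before a new step is taken.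
  have hstep : ∀ b ∈ B, ∀ A : ι, ∃ a ∈ A.1, b + (a - a₀) ∈ B := by
    rintro _ ⟨c, hc, rfl⟩ A
    rw [Set.mem_Iic] at hc
    by_cases hlt : ∃ a : Δ, c (A, a) < N (A, a)
    · obtain ⟨a, ha⟩ := hlt
      refine ⟨a.1, ?_, c + Pi.single (A, a) 1, hadd_le c hc _ ha, hSadd _ _⟩
      by_contra hcon
      simp [N, hcon] at ha
    · push Not at hlt
      obtain ⟨a, ha, hna⟩ := hn A
      let c' : ι × Δ → ℕ := fun x => if x.1 = A then 0 else c x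
      have hc' : c' ≤ N := fun x => by
        simp only [c']
        split_ifs
        · exact Nat.zero_le _
        · exact hc x
      have hS : S c' = S c := by
        simp only [S, Fintype.sum_prod_type, c']
        refine Finset.sum_congr rfl fun A' _ => ?_
        by_cases hA : A' = A
        · subst hA
          simp only [if_true, zero_smul, Finset.sum_const_zero]
          rw [← hN0 A']
          exact Finset.sum_congr rfl fun a _ => by rw [le_antisymm (hc _) (hlt a)]
        · simp [hA]
      refine ⟨a, ha, c' + Pi.single (A, ⟨a, hιΔ A ha⟩) 1, hadd_le c' hc' _ ?_, ?_⟩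
      · simpa [c', N, ha] using Nat.pos_of_ne_zero hna
      · rw [hSadd, hS]
  rintro ⟨-, hattr⟩
  obtain ⟨t, ht⟩ := hattr (conf Bᶜ) (hBfin.subset fun i hi => by
    by_contra hcon
    exact hi ((conf_apply _ _).2 hcon))
  -- The island moves by `-a₀` per step: every set of ones that would force a one at a translated
  -- site contains, by `hstep`, a site of the previous island.
  have key : ∀ t : ℕ, ∀ b ∈ B, (update f)^[t] (conf Bᶜ) (b - t • a₀) = false := by
    intro t
    induction t with
    | zero =>
      intro b hb
      rw [zero_smul, sub_zero, Function.iterate_zero, id, Bool.eq_false_iff, ne_eq, conf_apply]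
      exact fun h => h hb
    | succ t ih =>
      intro b hb
      by_contra hcon
      rw [Bool.not_eq_false, Function.iterate_succ_apply', update] at hcon
      set y := (update f)^[t] (conf Bᶜ)
      set A : Finset (Site d) := Δ.filter fun a => y (b - (t + 1) • a₀ + a) = true with hA
      have hfA : f (conf A) = true := by
        rw [← hcon]
        refine hΔ fun a ha => ?_
        rw [Bool.eq_iff_iff, conf_apply, Finset.mem_coe, hA, Finset.mem_filter]
        exact and_iff_right ha
      obtain ⟨a, ha, hab⟩ := hstep b hb ⟨A, Finset.mem_filter.2
        ⟨Finset.mem_powerset.2 (Finset.filter_subset _ _), hfA⟩⟩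
      have h1 := ih _ hab
      have h2 := (Finset.mem_filter.1 ha).2
      rw [show b + (a - a₀) - t • a₀ = b - (t + 1) • a₀ + a by rw [succ_nsmul]; abel, h2] at h1
      exact absurd h1 (by simp)
  have h0 : (0 : Site d) ∈ B := ⟨0, by simp [Set.mem_Iic], by simp [S]⟩
  have := key t 0 h0
  rw [ht] at this
  simp [allOnes] at this

/-! ### Finitely many directions that erase in linear time -/

/-- If "all ones" attracts and opposite fronts do not approach each other, then the velocities
are not dominated by a linear function. -/
theorem IsStandard.exists_inner_lt_velocity {d : ℕ} {f : Config d → Bool} (hf : IsStandard f)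
    (hattr : Attracts f (allOnes d))
    (hV : ∀ p : EuclideanSpace ℝ (Fin d), ‖p‖ = 1 → 0 ≤ velocity f p + velocity f (-p))
    (v : EuclideanSpace ℝ (Fin d)) :
    ∃ q : EuclideanSpace ℝ (Fin d), ‖q‖ = 1 ∧ inner ℝ v q < velocity f q := by
  by_contra! hcon
  obtain ⟨Δ, hΔ⟩ := hf.isLocal
  have hlin : ∀ q : EuclideanSpace ℝ (Fin d), ‖q‖ = 1 → velocity f q = inner ℝ v q := by
    intro q hq
    have h1 := hcon q hq
    have h2 := hcon (-q) (by rwa [norm_neg])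
    have h3 := hV q hq
    rw [inner_neg_right] at h2
    linarith
  have hunit : ∀ x : EuclideanSpace ℝ (Fin d), x ≠ 0 → ‖‖x‖⁻¹ • x‖ = 1 := fun x hx => by
    rw [norm_smul, norm_inv, norm_norm, inv_mul_cancel₀ (norm_ne_zero_iff.2 hx)]
  -- Otherwise some `x` avoids the finitely many hyperplanes orthogonal to the vectors `v + toSpace
  -- a`, whereas the velocity along `x` is attained at some `a ∈ Δ`.
  obtain ⟨a₀, -, ha₀⟩ : ∃ a ∈ Δ, v + toSpace a = 0 := by
    by_contra! hne
    obtain ⟨x, hx⟩ := Module.Dual.exists_forall_ne_zero_of_forall_exists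
      (fun a : Δ => ((innerSL ℝ (v + toSpace a.1)).toLinearMap :
        Module.Dual ℝ (EuclideanSpace ℝ (Fin d))))
      (fun a => ⟨v + toSpace a.1, inner_self_ne_zero.2 (hne a.1 a.2)⟩)
    have hx0 : x ≠ 0 := by
      rintro rfl
      -- Only the nonemptiness of `Δ` is needed here.
      obtain ⟨a, ha, -⟩ := hf.exists_velocity_eq hΔ 0
      exact hx ⟨a, ha⟩ (by simp)
    obtain ⟨a, ha, h1⟩ := hf.exists_velocity_eq hΔ (‖x‖⁻¹ • x)
    rw [hlin _ (hunit x hx0), inner_smul_right, inner_smul_right, ← mul_neg] at h1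
    have h2 := mul_left_cancel₀ (inv_ne_zero (norm_ne_zero_iff.2 hx0)) h1
    refine hx ⟨a, ha⟩ ?_
    simp only [ContinuousLinearMap.coe_coe, innerSL_apply_apply, inner_add_left]
    linarith
  refine not_attracts_allOnes hΔ (a₀ := a₀) (fun A hA => ?_) hattr
  -- A half-space containing `A` but strictly missing `a₀` would force a one at a level below the
  -- threshold given by $V_q=-\langle a_0,q\rangle$.
  by_contra hcv
  obtain ⟨g, u, hg, hu⟩ := geometric_hahn_banach_closed_point (convex_convexHull ℝ _)
    ((A.finite_toSet.image toSpace).isCompact_convexHull ℝ).isClosed hcv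
  obtain ⟨x, rfl⟩ := (InnerProductSpace.toDual ℝ _).surjective g
  simp only [InnerProductSpace.toDual_apply_apply] at hg hu
  have hg' : ∀ a ∈ A, inner ℝ x (toSpace a) < u := fun a ha =>
    hg _ (subset_convexHull ℝ _ (Set.mem_image_of_mem _ ha))
  have hx0 : x ≠ 0 := by
    rintro rfl
    have hAe : A = ∅ := by
      rw [Finset.eq_empty_iff_forall_notMem]
      intro a ha
      have := hg' a ha
      rw [inner_zero_left] at this hu
      exact absurd hu this.not_gt
    have : conf (A : Set (Site d)) = fun _ => false := by
      funext i
      rw [Bool.eq_false_iff, ne_eq, conf_apply]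
      simp [hAe]
    rw [this, hf.apply_false] at hA
    exact absurd hA (by simp)
  have hpos : 0 < ‖x‖⁻¹ := inv_pos.2 (norm_pos_iff.2 hx0)
  have h1 : f (front (‖x‖⁻¹ • x) (‖x‖⁻¹ * u)) = true := by
    refine hf.apply_true_of_le (fun i hi => ?_) hA
    rw [conf_apply] at hi
    rw [front_apply, inner_smul_right, real_inner_comm]
    exact mul_le_mul_of_nonneg_left (hg' i hi).le hpos.le
  rw [hf.apply_front, hlin _ (hunit x hx0), inner_smul_right, ← mul_add] at h1
  have h2 := nonneg_of_mul_nonneg_right h1 hpos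
  have h3 : inner ℝ v x = - inner ℝ x (toSpace a₀) := by
    rw [eq_neg_of_add_eq_zero_left ha₀, inner_neg_left, real_inner_comm]
  linarith

/-- Islands of zeros are erased in linear time: finitely many half-spaces of ones cover the
space in the end. -/
theorem IsStandard.exists_finset_directions {d : ℕ} {f : Config d → Bool} (hf : IsStandard f)
    (hattr : Attracts f (allOnes d))
    (hV : ∀ p : EuclideanSpace ℝ (Fin d), ‖p‖ = 1 → 0 ≤ velocity f p + velocity f (-p)) :
    ∃ (P : Finset (EuclideanSpace ℝ (Fin d))) (δ : ℝ), 0 < δ ∧ (∀ p ∈ P, ‖p‖ = 1) ∧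
      ∀ x : EuclideanSpace ℝ (Fin d), ∃ p ∈ P, δ - velocity f (-p) < inner ℝ x p := by
  classical
  obtain ⟨Δ, r, hr⟩ := hf.exists_range
  -- Closed sets of points not covered in direction `p` with slack `1 / (n + 1)`; together they have
  -- empty intersection.
  let t : {p : EuclideanSpace ℝ (Fin d) // ‖p‖ = 1} × ℕ → Set (EuclideanSpace ℝ (Fin d)) :=
    fun s => {x | inner ℝ x s.1.1 ≤ 1 / ((s.2 : ℝ) + 1) - velocity f (-s.1.1)}
  have htc : ∀ s, IsClosed (t s) := fun s =>
    isClosed_le (continuous_id.inner continuous_const) continuous_const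
  -- Adding the directions `±e k` confines every uncovered point to `|x k| ≤ 1 + r`, so compactness
  -- is needed only on this ball.
  set R : ℝ := √(∑ _k : Fin d, (1 + r) ^ 2) with hR
  have hempty : Metric.closedBall (0 : EuclideanSpace ℝ (Fin d)) R ∩ ⋂ s, t s = ∅ := by
    rw [Set.eq_empty_iff_forall_notMem]
    rintro x ⟨-, hx⟩
    rw [Set.mem_iInter] at hx
    obtain ⟨q, hq, hlt⟩ := hf.exists_inner_lt_velocity hattr hV x
    obtain ⟨n, hn⟩ := exists_nat_one_div_lt (sub_pos.2 hlt)
    have : inner ℝ x (-q) ≤ 1 / ((n : ℝ) + 1) - velocity f (- -q) :=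
      hx (⟨-q, by rwa [norm_neg]⟩, n)
    rw [neg_neg, inner_neg_right] at this
    linarith
  obtain ⟨u, hu⟩ := (isCompact_closedBall (0 : EuclideanSpace ℝ (Fin d)) R
    ).elim_finite_subfamily_closed t htc hempty
  obtain ⟨m, hm⟩ := (u.image Prod.snd).finite_toSet.bddAbove
  set e : Fin d → EuclideanSpace ℝ (Fin d) := fun k => EuclideanSpace.single k (1 : ℝ) with he
  refine ⟨u.image (fun s => s.1.1) ∪ (Finset.univ.image e ∪ Finset.univ.image fun k => -e k),
    1 / ((m : ℝ) + 1), by positivity, ?_, ?_⟩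
  · intro p hp
    simp only [Finset.mem_union, Finset.mem_image, Finset.mem_univ, true_and] at hp
    obtain ⟨s, -, rfl⟩ | ⟨k, rfl⟩ | ⟨k, rfl⟩ := hp
    · exact s.1.2
    · simp [he]
    · simp [he]
  · intro x
    by_contra! hcon
    have hm1 : 1 / ((m : ℝ) + 1) ≤ 1 := by
      rw [div_le_one (by positivity)]
      linarith [Nat.cast_nonneg (α := ℝ) m]
    have hnorm : ‖x‖ ≤ R := by
      rw [EuclideanSpace.norm_eq, hR]
      refine Real.sqrt_le_sqrt (Finset.sum_le_sum fun k _ => ?_)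
      have hek : ‖e k‖ = 1 := by simp [he]
      have h1 := hcon (e k) (by simp)
      have h2 := hcon (-e k) (by simp)
      have h3 := abs_le.1 (hf.abs_velocity_le hr hek)
      have h4 := abs_le.1 (hf.abs_velocity_le hr (p := -e k) (by rwa [norm_neg]))
      have h5 : inner ℝ x (e k) = x k := by simp [he, EuclideanSpace.inner_single_right]
      rw [neg_neg, inner_neg_right, h5] at h2
      rw [h5] at h1
      rw [Real.norm_eq_abs]
      refine pow_le_pow_left₀ (abs_nonneg _) (abs_le.2 ⟨?_, ?_⟩) 2 <;> linarith
    refine Set.eq_empty_iff_forall_notMem.1 hu x ⟨by simpa using hnorm, ?_⟩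
    simp only [Set.mem_iInter]
    intro s hs
    refine (hcon s.1.1 (by
      simp only [Finset.mem_union, Finset.mem_image]
      exact Or.inl ⟨s, hs, rfl⟩)).trans ?_
    have : s.2 ≤ m := hm (Finset.mem_coe.2 (Finset.mem_image_of_mem _ hs))
    have h6 : 1 / ((m : ℝ) + 1) ≤ 1 / ((s.2 : ℝ) + 1) :=
      one_div_le_one_div_of_le (by positivity) (by exact_mod_cast Nat.succ_le_succ this)
    linarith

/-! ### Counting lattice points in slabs -/

theorem abs_coord_le_norm {d : ℕ} (i : Site d) (k : Fin d) : |(i k : ℝ)| ≤ ‖toSpace i‖ := by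
  simpa [toSpace] using PiLp.norm_apply_le (toSpace i) k

theorem inner_toSpace {d : ℕ} (i : Site d) (p : EuclideanSpace ℝ (Fin d)) :
    inner ℝ (toSpace i) p = ∑ k, (i k : ℝ) * p k := by
  simp [PiLp.inner_apply, toSpace, mul_comm]

/-- A slab of bounded width contains at most `K * R ^ (d - 1)` lattice points of a ball of
radius `R`. -/
theorem exists_card_slab_le {d : ℕ} {p : EuclideanSpace ℝ (Fin d)} (hp : p ≠ 0) (w : ℝ) :
    ∃ K : ℝ, 0 ≤ K ∧ ∀ R : ℝ, 1 ≤ R → ∀ α : ℝ, ∃ S : Finset (Site d),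
      (∀ i, ‖toSpace i‖ ≤ R → α ≤ inner ℝ (toSpace i) p → inner ℝ (toSpace i) p ≤ α + w →
        i ∈ S) ∧ (S.card : ℝ) ≤ K * R ^ (d - 1) := by
  classical
  obtain ⟨k, hk⟩ : ∃ k, p k ≠ 0 := by
    by_contra! h
    exact hp (by ext k; simpa using h k)
  have hk' : 0 < |p k| := abs_pos.2 hk
  -- Once the other coordinates are fixed, the slab leaves at most `2 * M + 1` values for coordinate
  -- `k`.
  obtain ⟨M, hM⟩ := exists_nat_ge (w / |p k|)
  refine ⟨(2 * M + 1) * 3 ^ (d - 1), by positivity, fun R hR α => ?_⟩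
  set n : ℕ := ⌊R⌋₊ with hn
  have hnR : (n : ℝ) ≤ R := Nat.floor_le (by linarith)
  set S : Finset (Site d) := (Fintype.piFinset fun _ : Fin d => Finset.Icc (-(n : ℤ)) n).filter
    fun i => α ≤ inner ℝ (toSpace i) p ∧ inner ℝ (toSpace i) p ≤ α + w with hS
  set t : Finset (Site d) := Fintype.piFinset fun j : Fin d =>
    if j = k then {0} else Finset.Icc (-(n : ℤ)) n with ht
  have htcard : t.card = (2 * n + 1) ^ (d - 1) := by
    rw [ht, Fintype.card_piFinset, ← Finset.mul_prod_erase _ _ (Finset.mem_univ k)]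
    rw [if_pos rfl, Finset.card_singleton, one_mul]
    rw [Finset.prod_congr rfl (g := fun _ => 2 * n + 1)]
    · rw [Finset.prod_const, Finset.card_erase_of_mem (Finset.mem_univ k), Finset.card_univ,
        Fintype.card_fin]
    · intro j hj
      rw [if_neg (Finset.ne_of_mem_erase hj), Int.card_Icc]
      omega
  refine ⟨S, fun i hi h1 h2 => ?_, ?_⟩
  · rw [hS, Finset.mem_filter, Fintype.mem_piFinset]
    refine ⟨fun j => ?_, h1, h2⟩
    have h3 := (abs_coord_le_norm i j).trans hi
    have h4 : (i j).natAbs ≤ n := Nat.le_floor (by rw [Nat.cast_natAbs]; exact_mod_cast h3)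
    rw [Finset.mem_Icc]
    omega
  · have hcard : S.card ≤ (2 * M + 1) * t.card := by
      refine Finset.card_le_mul_card_image_of_maps_to (f := fun i => Function.update i k 0)
        (fun i hi => ?_) _ (fun b _ => ?_)
      · rw [ht, Fintype.mem_piFinset]
        intro j
        by_cases hj : j = k
        · subst hj; simp
        · rw [if_neg hj, Function.update_of_ne hj]
          exact Fintype.mem_piFinset.1 (Finset.mem_filter.1 hi).1 j
      · obtain h | ⟨i₀, hi₀⟩ := Finset.eq_empty_or_nonempty
          ({a ∈ S | Function.update a k 0 = b} : Finset (Site d))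
        · rw [h]; simp
        have hsame : ∀ i ∈ ({a ∈ S | Function.update a k 0 = b} : Finset (Site d)),
            ∀ j, j ≠ k → i j = i₀ j := by
          intro i hi j hj
          have h1 := (Finset.mem_filter.1 hi).2.trans (Finset.mem_filter.1 hi₀).2.symm
          simpa [hj] using congrFun h1 j
        calc _ ≤ (Finset.Icc (i₀ k - M) (i₀ k + M)).card := by
              refine Finset.card_le_card_of_injOn (fun i => i k) (fun i hi => ?_) ?_
              · have h1 := (Finset.mem_filter.1 (Finset.mem_filter.1 hi).1).2
                have h2 := (Finset.mem_filter.1 (Finset.mem_filter.1 hi₀).1).2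
                have h3 : inner ℝ (toSpace i) p - inner ℝ (toSpace i₀) p =
                    ((i k : ℝ) - i₀ k) * p k := by
                  rw [inner_toSpace, inner_toSpace, ← Finset.sum_sub_distrib,
                    Finset.sum_eq_single k (fun j _ hj => by rw [hsame i hi j hj, sub_self])
                    (by simp), sub_mul]
                have h4 : |((i k : ℝ) - i₀ k) * p k| ≤ w := by
                  rw [← h3, abs_le]
                  constructor <;> linarith [h1.1, h1.2, h2.1, h2.2]
                rw [abs_mul, ← le_div_iff₀ hk'] at h4
                have h5 : |i k - i₀ k| ≤ (M : ℤ) := by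
                  have h6 : ((|i k - i₀ k| : ℤ) : ℝ) ≤ ((M : ℤ) : ℝ) := by
                    push_cast
                    exact h4.trans hM
                  exact Int.cast_le.1 h6
                rw [abs_le] at h5
                simp only [Finset.coe_Icc, Set.mem_Icc]
                omega
              · intro i hi i' hi' h
                funext j
                by_cases hj : j = k
                · subst hj; exact h
                · rw [hsame i hi j hj, hsame i' hi' j hj]
          _ ≤ 2 * M + 1 := by
              rw [Int.card_Icc]
              omega
    calc (S.card : ℝ) ≤ (((2 * M + 1) * t.card : ℕ) : ℝ) := by exact_mod_cast hcard
      _ = (2 * M + 1) * (2 * n + 1) ^ (d - 1) := by rw [htcard]; push_cast; ring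
      _ ≤ (2 * M + 1) * (3 * R) ^ (d - 1) := by gcongr; linarith
      _ = _ := by rw [mul_pow, mul_assoc]

/-! ### Seeds of size $O(L^{d-1})$ -/

/-- Only the sites of `X` in the backward cone of the ball matter, so infinite slabs can be cut down
to finite seeds. -/
theorem IsStandard.iterate_update_conf_of_subset {d : ℕ} {f : Config d → Bool}
    (hf : IsStandard f) {Δ : Finset (Site d)} {r : ℝ} (hr : HasRange f Δ r) {X S : Set (Site d)}
    {L : ℝ} {T : ℕ} (hS : ∀ j ∈ X, ‖toSpace j‖ ≤ L + T * r → j ∈ S) {i : Site d}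
    (hi : ‖toSpace i‖ ≤ L) (hX : (update f)^[T] (conf X) i = true) :
    (update f)^[T] (conf S) i = true := by
  have h1 : (update f)^[T] (conf (X ∩ {j | ‖toSpace j‖ ≤ L + T * r})) i = true := by
    rw [← hX]
    refine hr.iterate_update_congr T i fun j hj => ?_
    rw [Bool.eq_iff_iff, conf_apply, conf_apply]
    exact ⟨fun h => h.1, fun h => ⟨h, hj.trans (by linarith)⟩⟩
  refine config_le_iff.1 (hf.monotone_update.iterate T (config_le_iff.2 fun j hj => ?_)) i h1
  rw [conf_apply] at hj ⊢
  exact hS j hj.1 hj.2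

/-- From `O(L ^ (d - 1))` well-placed ones the deterministic dynamics fills the ball of radius
`L`: a direction in which slabs expand. -/
theorem IsStandard.exists_seed_of_pos {d : ℕ} {f : Config d → Bool} (hf : IsStandard f)
    {p : EuclideanSpace ℝ (Fin d)} (hp : ‖p‖ = 1) (hV : 0 < velocity f p + velocity f (-p)) :
    ∃ K : ℝ, 0 ≤ K ∧ ∀ L : ℝ, 1 ≤ L → ∃ (S : Finset (Site d)) (T : ℕ),
      (S.card : ℝ) ≤ K * L ^ (d - 1) ∧
      ∀ i, ‖toSpace i‖ ≤ L → (update f)^[T] (conf (S : Set (Site d))) i = true := by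
  obtain ⟨Δ, r, hr⟩ := hf.exists_range
  have hr0 := hr.nonneg
  set s := velocity f p + velocity f (-p) with hs
  have hp0 : p ≠ 0 := by rintro rfl; simp at hp
  obtain ⟨K, hK, hcount⟩ := exists_card_slab_le hp0 (2 * r)
  set c : ℝ := 1 + (2 / s + 1) * r with hc
  have hc1 : 1 ≤ c := by
    have : 0 ≤ (2 / s + 1) * r := by positivity
    linarith
  refine ⟨K * c ^ (d - 1), by positivity, fun L hL => ?_⟩
  have hL0 : 0 ≤ L := by linarith
  -- Time for a slab whose width grows at rate `s` to gain width `2 * L`.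
  set T : ℕ := ⌈2 * L / s⌉₊ with hT
  have hT1 : 2 * L ≤ T * s := (div_le_iff₀ hV).1 (Nat.le_ceil _)
  have hT2 : (T : ℝ) ≤ (2 / s + 1) * L := by
    have h1 := (Nat.ceil_lt_add_one (a := 2 * L / s) (by positivity)).le
    have h2 : 2 * L / s = 2 / s * L := by ring
    rw [add_mul]
    linarith
  have hR : L + T * r ≤ c * L := by
    have := mul_le_mul_of_nonneg_right hT2 hr0
    rw [hc]
    linarith
  -- The offset puts the lower face exactly at `-L` at time `T`.
  obtain ⟨S, hS, hcard⟩ := hcount (c * L) (one_le_mul_of_one_le_of_one_le hc1 hL)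
    (T * velocity f (-p) - L)
  refine ⟨S, T, by rwa [mul_assoc, ← mul_pow], fun i hi => ?_⟩
  refine hf.iterate_update_conf_of_subset hr
    (X := {i | T * velocity f (-p) - L ≤ inner ℝ (toSpace i) p ∧
      inner ℝ (toSpace i) p ≤ T * velocity f (-p) - L + 2 * r})
    (fun j hj hjR => hS j (hjR.trans hR) hj.1 hj.2) hi ?_
  have h0 := abs_real_inner_le_norm (toSpace i) p
  rw [hp, mul_one] at h0
  have h1 := abs_le.1 (h0.trans hi)
  refine hf.iterate_update_slab hr hp hV.le (α := T * velocity f (-p) - L)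
    (β := T * velocity f (-p) - L + 2 * r) (by linarith)
    (fun j h2 h3 => ?_) T i (by linarith) ?_
  · rw [conf_apply]
    exact ⟨h2, h3⟩
  have : T * s = T * velocity f p + T * velocity f (-p) := by rw [hs, mul_add]
  linarith

/-- From `O(L ^ (d - 1))` well-placed ones the deterministic dynamics fills the ball of radius
`L`: slabs which persist and enclose islands of zeros. -/
theorem IsStandard.exists_seed_of_attracts {d : ℕ} {f : Config d → Bool} (hf : IsStandard f)
    (hattr : Attracts f (allOnes d))
    (hV : ∀ p : EuclideanSpace ℝ (Fin d), ‖p‖ = 1 → 0 ≤ velocity f p + velocity f (-p)) :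
    ∃ K : ℝ, 0 ≤ K ∧ ∀ L : ℝ, 1 ≤ L → ∃ (S : Finset (Site d)) (T : ℕ),
      (S.card : ℝ) ≤ K * L ^ (d - 1) ∧
      ∀ i, ‖toSpace i‖ ≤ L → (update f)^[T] (conf (S : Set (Site d))) i = true := by
  classical
  obtain ⟨Δ, r, hr⟩ := hf.exists_range
  have hr0 := hr.nonneg
  obtain ⟨P, δ, hδ, hP, hcover⟩ := hf.exists_finset_directions hattr hV
  have hcount : ∀ p : P, ∃ K : ℝ, 0 ≤ K ∧ ∀ R : ℝ, 1 ≤ R → ∀ α : ℝ, ∃ S : Finset (Site d),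
      (∀ i, ‖toSpace i‖ ≤ R → α ≤ inner ℝ (toSpace i) p.1 →
        inner ℝ (toSpace i) p.1 ≤ α + 2 * r → i ∈ S) ∧ (S.card : ℝ) ≤ K * R ^ (d - 1) :=
    fun p => exists_card_slab_le (by
      intro h
      have := hP p.1 p.2
      simp [h] at this) _
  choose K hK hcount using hcount
  set c : ℝ := 1 + (1 / δ + 1) * r with hc
  have hc1 : 1 ≤ c := by
    have : 0 ≤ (1 / δ + 1) * r := by positivity
    linarith
  -- Slabs with spacing `L` that meet the ball of radius `c * L` have index at most `M` in absolute
  -- value, because `L ≥ 1`.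
  obtain ⟨M, hM⟩ := exists_nat_ge (c + 2 * r)
  refine ⟨(∑ p : P, (2 * M + 1) * K p) * c ^ (d - 1),
    mul_nonneg (Finset.sum_nonneg fun p _ => mul_nonneg (by positivity) (hK p))
      (by positivity), fun L hL => ?_⟩
  have hL0 : 0 < L := by linarith
  set T : ℕ := ⌈L / δ⌉₊ with hT
  have hT0 : 0 < T := Nat.ceil_pos.2 (by positivity)
  have hT1 : L ≤ T * δ := (div_le_iff₀ hδ).1 (Nat.le_ceil _)
  have hT2 : (T : ℝ) ≤ (1 / δ + 1) * L := by
    have h1 := (Nat.ceil_lt_add_one (a := L / δ) (by positivity)).le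
    have h2 : L / δ = 1 / δ * L := by ring
    rw [add_mul]
    linarith
  have hR : L + T * r ≤ c * L := by
    have := mul_le_mul_of_nonneg_right hT2 hr0
    rw [hc]
    linarith
  choose S hS hcard using fun p : P => hcount p (c * L) (one_le_mul_of_one_le_of_one_le hc1 hL)
  refine ⟨Finset.univ.biUnion fun p : P =>
    (Finset.Icc (-(M : ℤ)) M).biUnion fun k : ℤ => S p (k * L), T, ?_, fun i hi => ?_⟩
  · have h1 : ∀ p : P, ((((Finset.Icc (-(M : ℤ)) M).biUnion
        fun k : ℤ => S p (k * L)).card : ℕ) : ℝ) ≤ (2 * M + 1) * K p * (c * L) ^ (d - 1) := by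
      intro p
      calc _ ≤ ((∑ k ∈ Finset.Icc (-(M : ℤ)) M, (S p (k * L)).card : ℕ) : ℝ) := by
            exact_mod_cast Finset.card_biUnion_le
        _ ≤ ∑ k ∈ Finset.Icc (-(M : ℤ)) M, K p * (c * L) ^ (d - 1) := by
            push_cast
            exact Finset.sum_le_sum fun k _ => hcard p _
        _ = _ := by
            rw [Finset.sum_const, Int.card_Icc, nsmul_eq_mul,
              show ((M : ℤ) + 1 - -(M : ℤ)).toNat = 2 * M + 1 by omega]
            push_cast
            ring
    calc _ ≤ ((∑ p : P, ((Finset.Icc (-(M : ℤ)) M).biUnion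
        fun k : ℤ => S p (k * L)).card : ℕ) : ℝ) := by
          exact_mod_cast Finset.card_biUnion_le
      _ ≤ ∑ p : P, (2 * M + 1) * K p * (c * L) ^ (d - 1) := by
          push_cast
          exact Finset.sum_le_sum fun p _ => h1 p
      _ = _ := by rw [← Finset.sum_mul, mul_pow, mul_assoc]
  · refine hf.iterate_update_conf_of_subset hr
      (X := {i | ∃ p ∈ P, ∃ k : ℤ, k * L ≤ inner ℝ (toSpace i) p ∧
        inner ℝ (toSpace i) p ≤ k * L + 2 * r}) ?_ hi ?_
    · rintro j ⟨p, hp, k, hk1, hk2⟩ hjR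
      have h0 := abs_real_inner_le_norm (toSpace j) p
      rw [hP p hp, mul_one] at h0
      have h1 := abs_le.1 (h0.trans (hjR.trans hR))
      have hrL : r ≤ r * L := le_mul_of_one_le_right hr0 hL
      have h2 : (k : ℝ) ≤ M := by
        refine le_trans ?_ hM
        have : (k : ℝ) * L ≤ c * L := hk1.trans h1.2
        have := le_of_mul_le_mul_right this hL0
        linarith
      have h3 : -(M : ℝ) ≤ k := by
        have : -(c + 2 * r) * L ≤ k * L := by linarith
        have := le_of_mul_le_mul_right this hL0
        linarith
      simp only [Finset.coe_biUnion, Set.mem_iUnion, Finset.mem_coe, Finset.mem_univ,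
        Finset.mem_Icc, exists_prop, true_and]
      exact ⟨⟨p, hp⟩, k, ⟨by exact_mod_cast h3, by exact_mod_cast h2⟩,
        hS ⟨p, hp⟩ _ j (hjR.trans hR) hk1 hk2⟩
    · refine hf.iterate_update_slabs_eq_allOnes hr hattr.1 hP (fun p hp => hV p (hP p hp)) hcover
        hL0 hT0 hT1 (fun j p hp k h1 h2 => ?_) i
      rw [conf_apply]
      exact ⟨p, hp, k, h1, h2⟩

/-! ### Noise and invariant measures -/

theorem measurableSet_agreeOn {d : ℕ} (z : Config d) (Λ : Set (Site d)) :
    MeasurableSet (agreeOn z Λ) := by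
  have : agreeOn z Λ = ⋂ i ∈ Λ, (fun x : Config d => x i) ⁻¹' {z i} := by
    ext x; simp [agreeOn]
  rw [this]
  exact MeasurableSet.biInter (Set.to_countable _) fun i _ =>
    measurable_pi_apply i (measurableSet_singleton _)

theorem noiseKernel_apply {d : ℕ} (ε : unitInterval) (x : Config d) :
    noiseKernel d ε x = Measure.infinitePi fun i => siteNoise ε (x i) := rfl

instance {d : ℕ} (ε : unitInterval) : IsMarkovKernel (noiseKernel d ε) :=
  ⟨fun x => by rw [noiseKernel_apply]; infer_instance⟩

/-- The noise only adds ones. -/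
theorem ae_le_noiseKernel {d : ℕ} (ε : unitInterval) (x : Config d) :
    ∀ᵐ y ∂(noiseKernel d ε x), x ≤ y := by
  simp only [Pi.le_def]
  rw [ae_all_iff]
  intro i
  cases hx : x i
  · simp
  · have h1 : ∀ᵐ b ∂(siteNoise ε (x i)), true ≤ b := by
      rw [hx, siteNoise, if_pos rfl, ae_dirac_iff (by simp)]
    rw [← Measure.infinitePi_map_eval (fun i => siteNoise ε (x i)) i] at h1
    exact ae_of_ae_map (measurable_pi_apply i).aemeasurable h1

theorem noise_apply {d : ℕ} (ε : unitInterval) (ν : Measure (Config d)) {A : Set (Config d)}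
    (hA : MeasurableSet A) : noise ε ν A = ∫⁻ x, noiseKernel d ε x A ∂ν :=
  Measure.bind_apply hA (noiseKernel d ε).measurable.aemeasurable

theorem le_noise_apply {d : ℕ} (ε : unitInterval) (ν : Measure (Config d)) {A : Set (Config d)}
    (hA : MeasurableSet A) (hup : IsUpperSet A) : ν A ≤ noise ε ν A := by
  rw [noise_apply ε ν hA, ← lintegral_indicator_one hA]
  refine lintegral_mono fun x => ?_
  by_cases hx : x ∈ A
  · have : noiseKernel d ε x A = 1 :=
      (mem_ae_iff_prob_eq_one hA).1 ((ae_le_noiseKernel ε x).mono fun y hy => hup hy hx)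
    rw [this]
    exact Set.indicator_le_self' (by simp) x
  · simp [hx]

/-- Preimages of increasing events are increasing, so each time step reduces to invariance and the
fact that noise can only raise their probability. -/
theorem IsInvariantMeasure.measure_preimage_iterate_le {d : ℕ} {f : Config d → Bool}
    (hf : IsStandard f) {ε : unitInterval} {μ : Measure (Config d)}
    (hμ : IsInvariantMeasure f ε μ) {A : Set (Config d)} (hA : MeasurableSet A)
    (hup : IsUpperSet A) (T : ℕ) : μ ((update f)^[T] ⁻¹' A) ≤ μ A := by
  induction T with
  | zero => simp
  | succ T ih =>
    refine le_trans ?_ ih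
    rw [Function.iterate_succ, Set.preimage_comp]
    have hA' := (hf.measurable_update.iterate T) hA
    rw [← Measure.map_apply hf.measurable_update hA']
    refine (le_noise_apply ε _ hA' fun x y hxy hx =>
      hup (hf.monotone_update.iterate T hxy) hx).trans ?_
    rw [hμ.2]

/-- Whatever the configuration before the noise, the sites become one independently, each with
probability at least `ε`. -/
theorem pow_card_le_noise_agreeOn {d : ℕ} (ε : unitInterval) (ν : Measure (Config d))
    [IsProbabilityMeasure ν] (S : Finset (Site d)) :
    ENNReal.ofReal ε ^ S.card ≤ noise ε ν (agreeOn (allOnes d) S) := by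
  rw [noise_apply ε ν (measurableSet_agreeOn _ _)]
  calc ENNReal.ofReal ε ^ S.card = ∫⁻ _, ENNReal.ofReal ε ^ S.card ∂ν := by simp
    _ ≤ _ := lintegral_mono fun x => ?_
  have : agreeOn (allOnes d) (S : Set (Site d)) = Set.pi S fun _ => {true} := by
    ext x; simp [agreeOn, allOnes]
  rw [this, noiseKernel_apply, Measure.infinitePi_pi _ (by simp)]
  refine Finset.pow_card_le_prod S _ _ fun i _ => ?_
  cases x i
  · simp [siteNoise]
  · simpa [siteNoise] using ε.2.2

theorem IsInvariantMeasure.pow_card_le {d : ℕ} {f : Config d → Bool} (hf : IsStandard f)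
    {ε : unitInterval} {μ : Measure (Config d)} (hμ : IsInvariantMeasure f ε μ)
    (S : Finset (Site d)) {T : ℕ} {Λ : Set (Site d)}
    (h : ∀ i ∈ Λ, (update f)^[T] (conf (S : Set (Site d))) i = true) :
    ENNReal.ofReal ε ^ S.card ≤ μ (agreeOn (allOnes d) Λ) := by
  have := hμ.1
  have hprob : IsProbabilityMeasure (μ.map (update f)) :=
    Measure.isProbabilityMeasure_map hf.measurable_update.aemeasurable
  have hup : IsUpperSet (agreeOn (allOnes d) Λ) := fun x y hxy hx i hi =>
    Bool.eq_true_of_true_le ((hx i hi).symm.le.trans (hxy i))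
  calc ENNReal.ofReal ε ^ S.card ≤ noise ε (μ.map (update f)) (agreeOn (allOnes d) S) :=
        pow_card_le_noise_agreeOn ε _ S
    _ = μ (agreeOn (allOnes d) S) := by rw [hμ.2]
    _ ≤ μ ((update f)^[T] ⁻¹' agreeOn (allOnes d) Λ) := measure_mono fun x hx => by
        refine hup (hf.monotone_update.iterate T (a := conf (S : Set (Site d))) fun i => ?_) h
        rw [Bool.le_iff_imp]
        intro hi
        exact hx i (by simpa [conf] using hi)
    _ ≤ μ (agreeOn (allOnes d) Λ) :=
        hμ.measure_preimage_iterate_le hf (measurableSet_agreeOn _ _) hup T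

theorem IsInvariantMeasure.neg_log_le {d : ℕ} {f : Config d → Bool} (hf : IsStandard f)
    {ε : unitInterval} (hε : 0 < ε) {μ : Measure (Config d)} (hμ : IsInvariantMeasure f ε μ)
    (S : Finset (Site d)) {T : ℕ} {Λ : Set (Site d)}
    (h : ∀ i ∈ Λ, (update f)^[T] (conf (S : Set (Site d))) i = true) :
    -ENNReal.log (μ (agreeOn (allOnes d) Λ)) ≤ ((S.card * -Real.log ε : ℝ) : EReal) := by
  have h1 := ENNReal.log_le_log (hμ.pow_card_le hf S h)
  rw [ENNReal.log_pow, ENNReal.log_ofReal_of_pos hε] at h1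
  rw [mul_neg, EReal.coe_neg, EReal.neg_le_neg_iff, EReal.coe_mul]
  exact_mod_cast h1

/-! ### Gibbs measures and alignment suppression -/

/-- For a Gibbs measure the conditional probability of a spin value given the other spins is
bounded away from one. -/
theorem Interaction.exists_gibbsWeight_singleton_le {d : ℕ} (I : Interaction d) :
    ∃ q : ℝ, 0 < q ∧ q < 1 ∧ ∀ (i : Site d) (σ : ({i} : Finset (Site d)) → Bool) (ω : Config d),
      I.gibbsWeight {i} σ ω ≤ q := by
  classical
  obtain ⟨K, hK⟩ := I.summable
  have hE : ∀ i ω, |I.energy {i} ω| ≤ K := by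
    intro i ω
    have h1 : ‖I.energy {i} ω‖ₑ ≤ K := by
      refine enorm_tsum_le_tsum_enorm.trans (le_trans ?_ (hK i))
      have e : ∀ A : Finset (Site d), ¬ Disjoint A {i} ↔ i ∈ A := fun A => by simp
      rw [← (Equiv.subtypeEquivRight e).tsum_eq]
      exact ENNReal.tsum_le_tsum fun A => le_iSup (fun ω => ‖I.Φ A ω‖ₑ) ω
    rw [← ofReal_norm, ← ENNReal.ofReal_coe_nnreal,
      ENNReal.ofReal_le_ofReal_iff K.coe_nonneg] at h1
    exact h1
  -- Both energies lie in `[-K, K]`, so the other spin value has at least `exp (-2K)` times the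
  -- weight of `σ`.
  refine ⟨1 / (1 + Real.exp (-(2 * K))), by positivity, ?_, fun i σ ω => ?_⟩
  · rw [div_lt_one (by positivity)]
    linarith [Real.exp_pos (-(2 * (K : ℝ)))]
  · obtain ⟨τ, hτ⟩ : ∃ τ : ({i} : Finset (Site d)) → Bool, τ ≠ σ := exists_ne σ
    set w : (({i} : Finset (Site d)) → Bool) → ℝ :=
      fun τ => Real.exp (-I.energy {i} (patch {i} τ ω)) with hw
    have hpos : ∀ τ, 0 < w τ := fun τ => Real.exp_pos _
    have h1 : w σ + w τ ≤ ∑ τ, w τ := by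
      rw [← Finset.sum_pair hτ.symm]
      exact Finset.sum_le_sum_of_subset_of_nonneg (Finset.subset_univ _)
        fun τ _ _ => (hpos τ).le
    have h2 : w σ * Real.exp (-(2 * K)) ≤ w τ := by
      rw [hw, ← Real.exp_add, Real.exp_le_exp]
      have h3 := abs_le.1 (hE i (patch {i} σ ω))
      have h4 := abs_le.1 (hE i (patch {i} τ ω))
      linarith
    have h5 : I.gibbsWeight {i} σ ω = w σ / ∑ τ, w τ := rfl
    rw [h5, div_le_div_iff₀ (by linarith [hpos σ, hpos τ]) (by positivity)]
    linarith

/-- The single-site equation peels off one site of `Λ` at a time, at the price of a factor `q`. -/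
theorem Interaction.IsGibbsMeasure.exists_agreeOn_le_pow {d : ℕ} {I : Interaction d}
    {μ : Measure (Config d)} (hμ : I.IsGibbsMeasure μ) :
    ∃ q : ℝ, 0 < q ∧ q < 1 ∧ ∀ (z : Config d) (Λ : Finset (Site d)),
      μ (agreeOn z Λ) ≤ ENNReal.ofReal q ^ Λ.card := by
  classical
  obtain ⟨q, hq0, hq1, hq⟩ := I.exists_gibbsWeight_singleton_le
  refine ⟨q, hq0, hq1, fun z Λ => ?_⟩
  have := hμ.1
  induction Λ using Finset.induction_on with
  | empty => simpa using prob_le_one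
  | insert i Λ hi ih =>
    rw [hμ.2 {i} _ (measurableSet_agreeOn z _), Finset.card_insert_of_notMem hi, pow_succ']
    refine le_trans (lintegral_mono (g := fun ω =>
      ENNReal.ofReal q * (agreeOn z (Λ : Set (Site d))).indicator 1 ω) fun ω => ?_) ?_
    · rw [Finset.sum_eq_single (fun _ => z i)]
      · refine mul_le_mul' (ENNReal.ofReal_le_ofReal (hq _ _ _)) ?_
        by_cases h : patch {i} (fun _ => z i) ω ∈
            agreeOn z ((insert i Λ : Finset (Site d)) : Set (Site d))
        · have h1 : ω ∈ agreeOn z (Λ : Set (Site d)) := fun j hj => by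
            have h2 := h j (by simp at hj ⊢; exact Or.inr hj)
            have h3 : j ∉ ({i} : Finset (Site d)) := by
              rw [Finset.mem_singleton]
              rintro rfl
              exact hi hj
            rwa [patch, dif_neg h3] at h2
          rw [Set.indicator_of_mem h, Set.indicator_of_mem h1]
          rfl
        · rw [Set.indicator_of_notMem h]
          exact zero_le
      · intro σ _ hσ
        rw [Set.indicator_of_notMem, mul_zero]
        intro h
        refine hσ (funext fun j => ?_)
        have h1 := h i (by simp)
        obtain ⟨j, hj⟩ := j
        obtain rfl := Finset.mem_singleton.1 hj
        rwa [patch, dif_pos hj] at h1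
      · simp
    · rw [lintegral_const_mul _ (measurable_one.indicator (measurableSet_agreeOn z _)),
        lintegral_indicator_one (measurableSet_agreeOn z _)]
      exact mul_le_mul_right ih _

/-- Gibbs measures have the alignment-suppression property. -/
theorem IsGibbsian.hasASP {d : ℕ} {μ : Measure (Config d)} (hμ : IsGibbsian μ) : HasASP μ := by
  obtain ⟨I, hI⟩ := hμ
  obtain ⟨q, hq0, hq1, hq⟩ := hI.exists_agreeOn_le_pow
  refine fun z => ⟨-Real.log q, neg_pos.2 (Real.log_neg hq0 hq1), fun Λ => ?_⟩
  have h1 := ENNReal.log_le_log (hq z Λ)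
  rw [ENNReal.log_pow, ENNReal.log_ofReal_of_pos hq0] at h1
  rw [neg_mul, EReal.coe_neg, EReal.neg_le_neg_iff, mul_comm, EReal.coe_mul]
  exact_mod_cast h1

/-- Subvolume-order alignment probabilities exclude the alignment-suppression property. -/
theorem not_hasASP_of_neg_log_le {d : ℕ} (hd : 0 < d) {μ : Measure (Config d)} {z : Config d}
    {C : ℝ} (h : ∀ L : ℝ, 1 ≤ L →
      -ENNReal.log (μ (agreeOn z (sphere d L))) ≤ ((C * L ^ (d - 1) : ℝ) : EReal)) :
    ¬ HasASP μ := by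
  classical
  intro hASP
  obtain ⟨c, hc, hcΛ⟩ := hASP z
  have hd1 : (1 : ℝ) ≤ d := by exact_mod_cast hd
  have key : ∀ n : ℕ, 1 ≤ n → c * n ≤ C * d ^ (d - 1) := by
    intro n hn
    have hn1 : (1 : ℝ) ≤ n := by exact_mod_cast hn
    -- A cube of `n ^ d` sites inside the ball of radius `d * n`: volume order against surface order
    -- bounds `n`.
    set Λ : Finset (Site d) := Fintype.piFinset fun _ => Finset.Icc 1 (n : ℤ) with hΛ
    have hcard : Λ.card = n ^ d := by simp [hΛ]
    have hsub : (Λ : Set (Site d)) ⊆ sphere d (d * n) := by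
      intro i hi
      rw [Finset.mem_coe, hΛ, Fintype.mem_piFinset] at hi
      have h1 : toSpace i = ∑ k, (i k : ℝ) • EuclideanSpace.single k (1 : ℝ) := by
        ext k
        simp [toSpace, Finset.sum_apply, Pi.single_apply]
      change ‖toSpace i‖ ≤ d * n
      rw [h1]
      refine (norm_sum_le _ _).trans ?_
      refine (Finset.sum_le_card_nsmul _ _ (n : ℝ) fun k _ => ?_).trans (by simp)
      have h2 := Finset.mem_Icc.1 (hi k)
      rw [norm_smul, PiLp.norm_single, norm_one, mul_one, Real.norm_eq_abs, abs_le]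
      constructor
      · have : (0 : ℝ) ≤ i k := by exact_mod_cast (zero_le_one.trans h2.1)
        linarith
      · exact_mod_cast h2.2
    have h1 := hcΛ Λ
    have h2 := h (d * n) (one_le_mul_of_one_le_of_one_le hd1 hn1)
    have h3 : -ENNReal.log (μ (agreeOn z Λ)) ≤ -ENNReal.log (μ (agreeOn z (sphere d (d * n)))) :=
      EReal.neg_le_neg_iff.2 (ENNReal.log_le_log
        (measure_mono fun x hx i hi => hx i (hsub hi)))
    have h4 := EReal.coe_le_coe_iff.1 ((h1.trans h3).trans h2)
    rw [hcard, mul_pow, ← mul_assoc, ← Nat.sub_add_cancel hd, Nat.add_sub_cancel, Nat.cast_pow,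
      pow_succ', ← mul_assoc] at h4
    rw [Nat.sub_add_cancel hd] at h4
    exact le_of_mul_le_mul_right h4 (by positivity)
  obtain ⟨n, hn⟩ := exists_nat_gt (C * d ^ (d - 1) / c)
  rw [div_lt_iff₀ hc] at hn
  have h1 := key (n + 1) (by omega)
  push_cast at h1
  linarith

end CellularAutomata

theorem theorem3 (d : ℕ) (hd : 1 < d) (f : CellularAutomata.Config d → Bool)
    (hf : CellularAutomata.IsStandard f)
    (hattr : CellularAutomata.Attracts f (CellularAutomata.allOnes d))
    (hV : (∀ p : EuclideanSpace ℝ (Fin d), ‖p‖ = 1 →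
            0 ≤ CellularAutomata.velocity f p + CellularAutomata.velocity f (-p)) ∨
          (∃ p : EuclideanSpace ℝ (Fin d), ‖p‖ = 1 ∧
            0 < CellularAutomata.velocity f p + CellularAutomata.velocity f (-p)))
    (ε : unitInterval) (hε : 0 < ε) (μ : MeasureTheory.Measure (CellularAutomata.Config d))
    (hμ : CellularAutomata.IsInvariantMeasure f ε μ) :
    (∃ C : ℝ, 0 < C ∧ ∀ L : ℝ, 1 ≤ L →
      -ENNReal.log (μ (CellularAutomata.agreeOn (CellularAutomata.allOnes d)
          (CellularAutomata.sphere d L))) ≤ ((C * L ^ (d - 1) : ℝ) : EReal)) ∧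
    ¬ CellularAutomata.HasASP μ ∧
    ¬ CellularAutomata.IsGibbsian μ := by
  obtain ⟨K, hK, hseed⟩ : ∃ K : ℝ, 0 ≤ K ∧ ∀ L : ℝ, 1 ≤ L →
      ∃ (S : Finset (CellularAutomata.Site d)) (T : ℕ), (S.card : ℝ) ≤ K * L ^ (d - 1) ∧
      ∀ i, ‖CellularAutomata.toSpace i‖ ≤ L → (CellularAutomata.update f)^[T]
        (CellularAutomata.conf (S : Set (CellularAutomata.Site d))) i = true := by
    obtain hV | ⟨p, hp, hV⟩ := hV
    · exact hf.exists_seed_of_attracts hattr hV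
    · exact hf.exists_seed_of_pos hp hV
  have hlog : 0 ≤ -Real.log ε := neg_nonneg.2 (Real.log_nonpos ε.2.1 ε.2.2)
  -- The added `1` keeps the constant positive even if `K = 0` or `ε = 1`.
  have hbound : ∀ L : ℝ, 1 ≤ L →
      -ENNReal.log (μ (CellularAutomata.agreeOn (CellularAutomata.allOnes d)
        (CellularAutomata.sphere d L))) ≤
        (((K * -Real.log ε + 1) * L ^ (d - 1) : ℝ) : EReal) := by
    intro L hL
    obtain ⟨S, T, hcard, hS⟩ := hseed L hL
    refine (hμ.neg_log_le hf hε S (T := T) fun i hi => hS i hi).trans ?_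
    have h1 := mul_le_mul_of_nonneg_right hcard hlog
    have h2 : (0 : ℝ) ≤ L ^ (d - 1) := by positivity
    refine EReal.coe_le_coe_iff.2 ?_
    linarith
  have hASP := CellularAutomata.not_hasASP_of_neg_log_le (by omega) hbound
  exact ⟨⟨_, by positivity, hbound⟩, hASP, fun h => hASP h.hasASP⟩
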